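/- Let $|\phi\rangle\in\mathbb{C}^{a}\otimes\mathbb{C}^{b}$ and $|\psi\rangle\in\mathbb{C}^{a'}\otimes\mathbb{C}^{b'}$ be unit vectors (pure states shared by Alice, who holds the first factor, and Bob, who holds the second), and write $\operatorname{Tr}_B\phi$, $\operatorname{Tr}_B\psi$ for Alice's reduced density operators. For a density operator $\rho$ with eigenvalues $r_j$ (listed with multiplicity) and $0\le\eta<1$ put $$\Delta_\eta(\rho)=\log\min\Bigl\{|J|\,\max_{j\in J}r_j \;:\; \sum_{j\in J}r_j\ge 1-\eta\Bigr\},$$ where $J$ runs over the sets of eigenvalue indices and $\log$ is to base $2$; thus $\Delta_0(\rho)=\log\operatorname{rank}\rho+\log\|\rho\|_\infty$. Consider protocols of local operations and classical communication with finitely many rounds: in each round one party applies a quantum instrument to its own (finite-dimensional) system and announces the outcome, one of $d$ possible messages, to the other party; what is done next may depend on all previous messages. Such a message counts as $\log d$ bits, and the total number $C$ of bits exchanged by the protocol is the maximum, over all message sequences, of the sum of these costs. Let $0\le\varepsilon<1/4$ and suppose that such a protocol, exchanging a total of $C$ classical bits, turns $|\phi\rangle$ into a (possibly mixed) state $\tilde\rho$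 with $F(|\psi\rangle\langle\psi|,\tilde\rho)\ge 1-\varepsilon$, where $F(\sigma,\omega)=\bigl(\operatorname{Tr}\sqrt{\sigma^{1/2}\omega\,\sigma^{1/2}}\bigr)^2$ is the Uhlmann fidelity. Then, with $\delta=\sqrt[8]{4\varepsilon}$, $$C\;\ge\;\Delta_\delta(\operatorname{Tr}_B\psi)-\Delta_0(\operatorname{Tr}_B\phi)+2\log(1-\delta).$$ -/

import Mathlib

open scoped Matrix Kronecker

noncomputable section

namespace EntanglementCost

/-- Operators on the bipartite system `ℂ^a ⊗ ℂ^b`; the first factor is Alice's, the second is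
Bob's. -/
abbrev BipartiteOp (a b : ℕ) : Type :=
  Matrix (Fin a × Fin b) (Fin a × Fin b) ℂ

/-- The operator `|φ⟩⟨φ|`. -/
def pureDensity {a b : ℕ} (φ : EuclideanSpace ℂ (Fin a × Fin b)) : BipartiteOp a b :=
  Matrix.of fun i j => φ i * star (φ j)

/-- The partial trace `Tr_B` over Bob's system. -/
def traceB {a b : ℕ} (ρ : BipartiteOp a b) : Matrix (Fin a) (Fin a) ℂ :=
  Matrix.of fun i j => ∑ k : Fin b, ρ (i, k) (j, k)

theorem isHermitian_traceB_pureDensity {a b : ℕ} (φ : EuclideanSpace ℂ (Fin a × Fin b)) :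
    (traceB (pureDensity φ)).IsHermitian := by
  ext i j
  simp [traceB, pureDensity, mul_comm]

/-- The quantity `Δ_ε(ρ) = log₂ min {|J| (max_{j ∈ J} r_j) : ∑_{j ∈ J} r_j ≥ 1 - ε}` of a
self-adjoint operator `ρ` with eigenvalues `r_j`, listed with multiplicity. There are only finitely
many index sets `J`, so the infimum is a minimum; for a state and `0 ≤ ε < 1` admissible sets exist,
and all of them are automatically nonempty. -/
def smoothDelta {n : Type*} [Fintype n] [DecidableEq n] {ρ : Matrix n n ℂ}
    (hρ : ρ.IsHermitian) (ε : ℝ) : ℝ :=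
  Real.logb 2 (sInf {x : ℝ | ∃ (J : Finset n) (hJ : J.Nonempty),
    1 - ε ≤ ∑ j ∈ J, hρ.eigenvalues j ∧ x = (J.card : ℝ) * J.sup' hJ hρ.eigenvalues})

/-- `Δ_ε(Tr_B |φ⟩⟨φ|)`. -/
def entanglementDelta {a b : ℕ} (ε : ℝ) (φ : EuclideanSpace ℂ (Fin a × Fin b)) : ℝ :=
  smoothDelta (isHermitian_traceB_pureDensity φ) ε

open scoped MatrixOrder ComplexOrder in
/-- The Uhlmann fidelity `F(σ, ω) = (Tr √(√σ ω √σ))²`. -/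
def fidelity {n : Type*} [Fintype n] [DecidableEq n] (σ ω : Matrix n n ℂ) : ℝ :=
  (Matrix.trace (CFC.sqrt (CFC.sqrt σ * ω * CFC.sqrt σ))).re ^ 2

/-- A quantum instrument on the local system `ℂ^a` with outcomes `m = 0, …, d - 1`: on outcome `m`
the (unnormalised) state becomes `∑ k, K m k ρ (K m k)ᴴ`, a state of the system `ℂ^(out m)`. -/
structure Instrument (a : ℕ) {d : ℕ} (out : Fin d → ℕ) where
  /-- The number of Kraus operators of each outcome. -/
  num : Fin d → ℕ
  /-- The Kraus operators. -/
  K : ∀ m : Fin d, Fin (num m) → Matrix (Fin (out m)) (Fin a) ℂ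
  /-- Completeness: the outcomes have total probability one. -/
  complete : ∑ m : Fin d, ∑ k : Fin (num m), (K m k)ᴴ * K m k = 1

/-- `LOCC a' b' a b` is the type of the protocols with local operations and classical communication
that transform states of `ℂ^a ⊗ ℂ^b` into states of `ℂ^a' ⊗ ℂ^b'`. In a round one of the parties
applies an instrument to its own system and tells the outcome `m ∈ {0, …, d - 1}` to the other
party. Everything that follows, also whose turn it is and how many messages are possible, may depend
on the messages exchanged so far. With `d = 1` a round is a local quantum operation without
communication. -/
inductive LOCC (a' b' : ℕ) : ℕ → ℕ → Type
  | done : LOCC a' b' a' b'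
  | alice {a b : ℕ} (d : ℕ) (hd : 0 < d) (out : Fin d → ℕ) (I : Instrument a out)
      (next : ∀ m : Fin d, LOCC a' b' (out m) b) : LOCC a' b' a b
  | bob {a b : ℕ} (d : ℕ) (hd : 0 < d) (out : Fin d → ℕ) (I : Instrument b out)
      (next : ∀ m : Fin d, LOCC a' b' a (out m)) : LOCC a' b' a b

/-- The output of a protocol on a given input, averaged over all the transcripts. -/
def LOCC.run {a' b' : ℕ} : {a b : ℕ} → LOCC a' b' a b → BipartiteOp a b → BipartiteOp a' b'
  | _, _, .done, ρ => ρ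
  | _, b, .alice _ _ _ I next, ρ =>
      ∑ m, (next m).run (∑ k, (I.K m k ⊗ₖ (1 : Matrix (Fin b) (Fin b) ℂ)) * ρ *
        (I.K m k ⊗ₖ (1 : Matrix (Fin b) (Fin b) ℂ))ᴴ)
  | a, _, .bob _ _ _ I next, ρ =>
      ∑ m, (next m).run (∑ k, ((1 : Matrix (Fin a) (Fin a) ℂ) ⊗ₖ I.K m k) * ρ *
        ((1 : Matrix (Fin a) (Fin a) ℂ) ⊗ₖ I.K m k)ᴴ)

/-- The total number of classical bits exchanged, in the worst case over all transcripts: a message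
from a set of `d` possible messages counts as `log₂ d` bits, in either direction. -/
def LOCC.bits {a' b' : ℕ} : {a b : ℕ} → LOCC a' b' a b → ℝ
  | _, _, .done => 0
  | _, _, .alice d _ _ _ next => Real.logb 2 d + ⨆ m, (next m).bits
  | _, _, .bob d _ _ _ next => Real.logb 2 d + ⨆ m, (next m).bits

end EntanglementCost

end

namespace EntanglementCost

/-! A protocol is flattened into at most `2 ^ P.bits` transcripts (`LOCC.exists_separableForm`). In
transcript `t` the parties act by independent contractive Kraus families, so the unnormalised final
state, with Kraus indices kept as extra subsystems, is a matrix `M_t = V Φ Yᵀ` with `V`, `Y`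
contractions. Hence `rank M_t ≤ R` and `M_t M_tᴴ ≤ L`, where `R` and `L` bound the rank and the norm
of `Tr_B φ`, while the traces of `M_t M_tᴴ` sum to one.

The fidelity is `∑_t ‖χ_t‖²`, where `χ_t` (Hilbert–Schmidt norm) contains the overlaps of the blocks
of `M_t` with `Ψ`; this also equals `∑_t tr (M_t (χ_t ⊗ Ψ)ᴴ)`. In an eigenbasis of `(χ_t χ_tᴴ) ⊗ (Ψ
Ψᴴ)` the diagonal terms of this trace are at most `√(c_k r_j p ν)`: the weights `p ≤ 1` sum to at
most the rank, and `ν ≤ L` is the diagonal of `M_t M_tᴴ` (`exists_overlap_weights`).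

High fidelity thus makes `c_k r_j` close to weights bounded by `L` and supported on about `2 ^
P.bits * R` indices. Averaging over `k` finds one `k` for which the indices `j` with `p` near 1
carry most of `r`; they form the smoothing set (`exists_smoothing_set`). -/

/-! ### Scalar estimates and extraction of the smoothing set -/

/-- After division by `δ`, the difference has positive coefficients in the Bernstein monomials `δ ^
i * (1 - δ) ^ (6 - i)`. The factors on the right are the losses in `exists_smoothing_set`. -/
theorem sq_one_sub_lt_smoothing_factor {δ : ℝ} (h₀ : 0 < δ) (h₁ : δ < 1) :
    (1 - δ) ^ 2 < (1 - 7 / 10 * δ) ^ 2 * (1 - 9 / 10 * δ ^ 2) * (1 - 817 / 1000 * δ ^ 3) := by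
  have h : 0 < 1 - δ := by linarith
  have key : (1 - 7 / 10 * δ) ^ 2 * (1 - 9 / 10 * δ ^ 2) * (1 - 817 / 1000 * δ ^ 3) - (1 - δ) ^ 2
      = δ * (3 / 5 * (1 - δ) ^ 6 + 219 / 100 * (δ * (1 - δ) ^ 5) + 2393 / 1000 * (δ ^ 2 * (1 - δ) ^ 4)
        + 937 / 2500 * (δ ^ 3 * (1 - δ) ^ 3) + 137 / 100000 * (δ ^ 4 * (1 - δ) ^ 2)
        + 1773 / 25000 * (δ ^ 5 * (1 - δ)) + 1647 / 1000000 * δ ^ 6) := by ring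
  have : 0 < δ * (3 / 5 * (1 - δ) ^ 6 + 219 / 100 * (δ * (1 - δ) ^ 5)
        + 2393 / 1000 * (δ ^ 2 * (1 - δ) ^ 4)
        + 937 / 2500 * (δ ^ 3 * (1 - δ) ^ 3) + 137 / 100000 * (δ ^ 4 * (1 - δ) ^ 2)
        + 1773 / 25000 * (δ ^ 5 * (1 - δ)) + 1647 / 1000000 * δ ^ 6) := by positivity
  linarith

/-- A bound `u² y (1 - g) ≤ (√y)² + (√ν)² - 2 √(y π ν)`, where `g = π` if `(1 - u)² y ≤ L` and `0`
otherwise; here `y = s²` and `ν = t²`. -/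
theorem sq_mul_one_sub_truncation_le {s t p L u : ℝ} (hs : 0 ≤ s) (ht : 0 ≤ t) (hp₀ : 0 ≤ p)
    (hp₁ : p ≤ 1) (htL : t ^ 2 ≤ L) (hu₀ : 0 ≤ u) (hu₁ : u ≤ 1) :
    u ^ 2 * (s ^ 2 * (1 - if (1 - u) ^ 2 * s ^ 2 ≤ L then p ^ 2 else 0))
      ≤ s ^ 2 + t ^ 2 - 2 * (s * p * t) := by
  split_ifs with h
  -- The right side is `s² (1 - p²) + (s p - t)²`.
  · have h1 : u ^ 2 ≤ 1 := pow_le_one₀ hu₀ hu₁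
    have h2 : 0 ≤ s ^ 2 * (1 - p ^ 2) := mul_nonneg (sq_nonneg _) (by nlinarith)
    nlinarith [sq_nonneg (s * p - t)]
  · push Not at h
    have h1 : t ≤ (1 - u) * s := by
      refine (sq_le_sq₀ ht (mul_nonneg (by linarith) hs)).1 ?_
      rw [mul_pow]
      linarith
    have h2 : (u * s) ^ 2 ≤ (s - t) ^ 2 :=
      pow_le_pow_left₀ (mul_nonneg hu₀ hs) (by linarith) 2
    have h3 : s * p * t ≤ s * t := by
      nlinarith [mul_nonneg hs ht]
    calc u ^ 2 * (s ^ 2 * (1 - 0)) = (u * s) ^ 2 := by ring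
      _ ≤ (s - t) ^ 2 := h2
      _ = s ^ 2 + t ^ 2 - 2 * (s * t) := by ring
      _ ≤ s ^ 2 + t ^ 2 - 2 * (s * p * t) := by linarith

/-- If the probability weights `c k * r j` overlap well with the weights `π * ν`, where `ν ≤ L` is
bounded and `π` has total mass at most `B`, then the distribution `r` has an index set of mass
`≥ 1 - δ` on which the cardinality times the maximum is at most about `B * L`. -/
theorem exists_smoothing_set {K ι : Type*} [Fintype K] [Fintype ι]
    (c : K → ℝ) (r : ι → ℝ) (x p ν : K → ι → ℝ) {ε δ B L : ℝ}
    (hδ₀ : 0 < δ) (hδ₁ : δ < 1) (hεδ : 4 * ε = δ ^ 8) (hB : 0 < B) (hL : 0 < L)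
    (hc : ∀ k, 0 ≤ c k) (hr : ∀ j, 0 ≤ r j) (hr1 : ∑ j, r j = 1)
    (hcq : 1 - ε ≤ ∑ k, c k)
    (hp₀ : ∀ k j, 0 ≤ p k j) (hp₁ : ∀ k j, p k j ≤ 1) (hpB : ∑ k, ∑ j, p k j ≤ B)
    (hν₀ : ∀ k j, 0 ≤ ν k j) (hνL : ∀ k j, ν k j ≤ L) (hν1 : ∑ k, ∑ j, ν k j ≤ 1)
    (hx : ∀ k j, x k j ≤ √(c k * r j * p k j * ν k j)) (hxq : ∑ k, ∑ j, x k j = ∑ k, c k) :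
    ∃ (J : Finset ι) (hJ : J.Nonempty), 1 - δ ≤ ∑ j ∈ J, r j ∧
      (J.card : ℝ) * J.sup' hJ r ≤ B * L / (1 - δ) ^ 2 := by
  classical
  -- `u` is the slack in the truncation and `z` the threshold for `g` to count as near 1. With these
  -- values `ε / (u² z δ)` is at most `567/1000 * δ³`, and the total loss stays below `1 - (1 -
  -- δ)²`.
  set u : ℝ := 7 / 10 * δ with hu
  set z : ℝ := 9 / 10 * δ ^ 2 with hz
  have hu₀ : 0 < u := by positivity
  have hu₁ : u < 1 := by rw [hu]; linarith
  have hz₀ : 0 < z := by positivity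
  have hz₁ : z < 1 := by rw [hz]; nlinarith
  have hL' : 0 < (1 - u) ^ 2 := pow_pos (sub_pos.2 hu₁) 2
  set g : K → ι → ℝ := fun k j => if (1 - u) ^ 2 * (c k * r j) ≤ L then p k j else 0 with hg
  have hg₀ : ∀ k j, 0 ≤ g k j := fun k j => by
    simp only [hg]; split_ifs; exacts [hp₀ k j, le_rfl]
  have hgp : ∀ k j, g k j ≤ p k j := fun k j => by
    simp only [hg]; split_ifs; exacts [le_rfl, hp₀ k j]
  have hgB : ∑ k, ∑ j, g k j ≤ B :=
    (Finset.sum_le_sum fun k _ => Finset.sum_le_sum fun j _ => hgp k j).trans hpB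
  have hterm : ∀ k j, u ^ 2 * (c k * r j * (1 - g k j)) ≤ c k * r j + ν k j - 2 * x k j := by
    intro k j
    have h := sq_mul_one_sub_truncation_le (Real.sqrt_nonneg (c k * r j))
      (Real.sqrt_nonneg (ν k j)) (Real.sqrt_nonneg (p k j))
      (Real.sqrt_le_one.2 (hp₁ k j)) ((Real.sq_sqrt (hν₀ k j)).trans_le (hνL k j)) hu₀.le hu₁.le
    rw [Real.sq_sqrt (mul_nonneg (hc k) (hr j)), Real.sq_sqrt (hν₀ k j), Real.sq_sqrt (hp₀ k j),
      ← Real.sqrt_mul (mul_nonneg (hc k) (hr j)),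
      ← Real.sqrt_mul (mul_nonneg (mul_nonneg (hc k) (hr j)) (hp₀ k j))] at h
    have := hx k j
    simp only [hg]
    linarith
  set d : K → ℝ := fun k => ∑ j, r j * (1 - g k j) with hd
  -- The sum of the right sides of `hterm` is at most `∑ c + 1 - 2 ∑ c = 1 - ∑ c ≤ ε`.
  have hdsum : u ^ 2 * ∑ k, c k * d k ≤ ε := by
    have h := Finset.sum_le_sum fun k (_ : k ∈ Finset.univ) =>
      Finset.sum_le_sum fun j (_ : j ∈ Finset.univ) => hterm k j
    simp only [Finset.sum_sub_distrib, Finset.sum_add_distrib, ← Finset.mul_sum, mul_assoc,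
      hr1] at h
    rw [hxq] at h
    simp only [hd]
    simp only [mul_one] at h
    linarith
  by_contra hcon
  push Not at hcon
  set X : ℝ := B * L / (1 - δ) ^ 2 with hX
  have h1δ : 0 < (1 - δ) ^ 2 := pow_pos (sub_pos.2 hδ₁) 2
  have hX₀ : 0 < X := by positivity
  have hk : ∀ k, c k * X ≤ L / ((1 - u) ^ 2 * (1 - z)) * (∑ j, g k j) + X / (z * δ) * (c k * d k) := by
    intro k
    have hd₀ : 0 ≤ d k := Finset.sum_nonneg fun j _ =>
      mul_nonneg (hr j) (by linarith [hgp k j, hp₁ k j])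
    have hG₀ : 0 ≤ ∑ j, g k j := Finset.sum_nonneg fun j _ => hg₀ k j
    have h1z : 0 < 1 - z := by linarith
    have hA : 0 ≤ L / ((1 - u) ^ 2 * (1 - z)) * (∑ j, g k j) := by positivity
    have hB' : 0 ≤ X / (z * δ) * (c k * d k) := by have := hc k; positivity
    -- Markov: a bad `k` is charged to `c k * d k`. For any other `k`, the set `J` where `g ≥ 1 - z`
    -- misses mass at most `δ`, so `hcon` applies to it.
    by_cases hbad : z * δ < d k
    · have : c k * X ≤ X / (z * δ) * (c k * d k) := by
        rw [div_mul_eq_mul_div, le_div_iff₀ (by positivity)]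
        have := mul_le_mul_of_nonneg_left hbad.le (mul_nonneg (hc k) hX₀.le)
        linarith
      linarith
    · push Not at hbad
      set J := Finset.univ.filter fun j => 1 - z ≤ g k j with hJ
      have hmass : 1 - δ ≤ ∑ j ∈ J, r j := by
        have hsplit := Finset.sum_filter_add_sum_filter_not Finset.univ
          (fun j => 1 - z ≤ g k j) r
        have h2 : z * ∑ j ∈ Finset.univ.filter (fun j => ¬ 1 - z ≤ g k j), r j ≤ d k := by
          rw [Finset.mul_sum]
          refine (Finset.sum_le_sum fun j hj => ?_).trans
            (Finset.sum_le_sum_of_subset_of_nonneg (Finset.filter_subset _ Finset.univ)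
              fun j _ _ => mul_nonneg (hr j) (by linarith [hgp k j, hp₁ k j]))
          have := (Finset.mem_filter.1 hj).2
          push Not at this
          rw [mul_comm]
          exact mul_le_mul_of_nonneg_left (by linarith) (hr j)
        have h3 := le_of_mul_le_mul_left (h2.trans hbad) hz₀
        rw [hr1] at hsplit
        linarith
      have hJne : J.Nonempty := by
        by_contra hne
        rw [Finset.not_nonempty_iff_eq_empty] at hne
        rw [hne, Finset.sum_empty] at hmass
        linarith
      have hlt := hcon J hJne hmass
      have hcard : (J.card : ℝ) * (1 - z) ≤ ∑ j, g k j := by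
        rw [← nsmul_eq_mul]
        exact (Finset.card_nsmul_le_sum J (g k) _ fun j hj => (Finset.mem_filter.1 hj).2).trans
          (Finset.sum_le_sum_of_subset_of_nonneg (Finset.filter_subset _ _) fun j _ _ => hg₀ k j)
      obtain ⟨j₀, hj₀, hj₀e⟩ := Finset.exists_mem_eq_sup' hJne r
      -- As `1 - z > 0`, membership of the maximiser in `J` means that `g` was not truncated to 0
      -- there.
      have hmax : (1 - u) ^ 2 * (c k * J.sup' hJne r) ≤ L := by
        rw [hj₀e]
        have h := (Finset.mem_filter.1 hj₀).2
        by_contra hne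
        simp only [hg, if_neg hne] at h
        linarith
      have : c k * X ≤ L / ((1 - u) ^ 2 * (1 - z)) * (∑ j, g k j) := by
        rw [div_mul_eq_mul_div, le_div_iff₀ (by positivity)]
        calc c k * X * ((1 - u) ^ 2 * (1 - z))
            ≤ c k * (J.card * J.sup' hJne r) * ((1 - u) ^ 2 * (1 - z)) :=
              mul_le_mul_of_nonneg_right (mul_le_mul_of_nonneg_left hlt.le (hc k)) (by positivity)
          _ = ((1 - u) ^ 2 * (c k * J.sup' hJne r)) * (J.card * (1 - z)) := by ring
          _ ≤ L * (J.card * (1 - z)) := mul_le_mul_of_nonneg_right hmax (by positivity)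
          _ ≤ L * ∑ j, g k j := mul_le_mul_of_nonneg_left hcard hL.le
      linarith
  have hsum := Finset.sum_le_sum fun k (_ : k ∈ Finset.univ) => hk k
  rw [← Finset.sum_mul, Finset.sum_add_distrib, ← Finset.mul_sum, ← Finset.mul_sum] at hsum
  have h1z : 0 < 1 - z := by linarith
  have h1 : L / ((1 - u) ^ 2 * (1 - z)) * (∑ k, ∑ j, g k j) ≤ L / ((1 - u) ^ 2 * (1 - z)) * B :=
    mul_le_mul_of_nonneg_left hgB (by positivity)
  have h2 : X / (z * δ) * ∑ k, c k * d k ≤ X * (567 / 1000 * δ ^ 3) := by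
    rw [div_mul_eq_mul_div, div_le_iff₀ (by positivity), mul_assoc]
    refine mul_le_mul_of_nonneg_left ?_ hX₀.le
    refine le_of_mul_le_mul_left (hdsum.trans ?_) (by positivity : 0 < u ^ 2)
    have : ε = δ ^ 8 / 4 := by linarith
    rw [this, hu, hz]
    nlinarith [pow_pos hδ₀ 8]
  have h3 : (1 - 817 / 1000 * δ ^ 3) * X ≤ L / ((1 - u) ^ 2 * (1 - z)) * B := by
    have h4 : (1 - 1 / 4 * δ ^ 3) * X ≤ (∑ k, c k) * X := by
      refine mul_le_mul_of_nonneg_right ?_ hX₀.le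
      have : δ ^ 8 ≤ δ ^ 3 := pow_le_pow_of_le_one hδ₀.le hδ₁.le (by norm_num)
      linarith
    linarith
  rw [div_mul_eq_mul_div L, le_div_iff₀ (by positivity)] at h3
  have h5 := mul_lt_mul_of_pos_right (sq_one_sub_lt_smoothing_factor hδ₀ hδ₁) hX₀
  have h6 : (1 - δ) ^ 2 * X = B * L := mul_div_cancel₀ _ h1δ.ne'
  rw [h6, ← hu, ← hz] at h5
  linarith

/-! ### Overlap of a low-rank matrix with orthogonal rows -/

/-- The rows of `W` are orthogonal with squared norms `y`. Take `p e` to be the squared norm of the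
projection of the normalised row onto the row space of `M`: Cauchy–Schwarz in that space gives the
last bound, and Bessel's inequality for each of its `M.rank` basis vectors bounds `∑ p`. -/
theorem exists_row_weights {E F : Type*} [Fintype E] [DecidableEq E] [Fintype F]
    (M W : Matrix E F ℂ) (y : E → ℝ)
    (hW : W * Wᴴ = Matrix.diagonal (fun e => (y e : ℂ))) :
    ∃ p : E → ℝ, (∀ e, 0 ≤ p e) ∧ (∀ e, p e ≤ 1) ∧ ∑ e, p e ≤ M.rank ∧
      ∀ e, ‖(M * Wᴴ) e e‖ ^ 2 ≤ y e * p e * ((M * Mᴴ) e e).re := by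
  classical
  let w : E → EuclideanSpace ℂ F := fun e => WithLp.toLp 2 (W e)
  let m : E → EuclideanSpace ℂ F := fun e => WithLp.toLp 2 (M e)
  have hinner : ∀ (A B : Matrix E F ℂ) (e e' : E),
      inner ℂ (WithLp.toLp 2 (A e) : EuclideanSpace ℂ F) (WithLp.toLp 2 (B e'))
        = (B * Aᴴ) e' e := by
    intro A B e e'
    rw [EuclideanSpace.inner_toLp_toLp]
    rfl
  have hy : ∀ e, ‖w e‖ ^ 2 = y e := by
    intro e
    rw [← inner_self_eq_norm_sq (𝕜 := ℂ), hinner, hW]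
    simp
  have hy₀ : ∀ e, 0 ≤ y e := fun e => hy e ▸ sq_nonneg _
  -- Since `0⁻¹ = 0`, zero rows get `v e = 0`; the other `v e` are orthonormal.
  let v : E → EuclideanSpace ℂ F := fun e => ((√(y e))⁻¹ : ℂ) • w e
  have hwv : ∀ e, w e = (√(y e) : ℂ) • v e := by
    intro e
    by_cases h : y e = 0
    · have : w e = 0 := by simpa [h] using hy e
      simp [v, this]
    · have : (√(y e) : ℂ) ≠ 0 := by
        exact_mod_cast (Real.sqrt_ne_zero (hy₀ e)).2 h
      simp only [v, smul_smul]
      rw [mul_inv_cancel₀ this, one_smul]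
  have hv0 : ∀ e, y e = 0 → v e = 0 := fun e h => by simp [v, h]
  have hvv : ∀ e e', inner ℂ (v e) (v e') = if e = e' ∧ y e ≠ 0 then 1 else 0 := by
    intro e e'
    simp only [v, inner_smul_left, inner_smul_right, w]
    rw [hinner, hW, Matrix.diagonal_apply]
    by_cases h : e = e'
    · subst h
      by_cases h0 : y e = 0
      · simp [h0]
      · have h1 : (√(y e) : ℂ) ≠ 0 := by exact_mod_cast (Real.sqrt_ne_zero (hy₀ e)).2 h0
        have h2 : (y e : ℂ) = (√(y e) : ℂ) * √(y e) := by
          exact_mod_cast (Real.mul_self_sqrt (hy₀ e)).symm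
        simp only [h0, ne_eq, not_false_eq_true, and_self, if_true, map_inv₀, Complex.conj_ofReal]
        rw [h2]
        field_simp
    · simp [h, Ne.symm h]
  let S := Submodule.span ℂ (Set.range m)
  have hS : Module.finrank ℂ S = M.rank := by
    rw [Matrix.rank_eq_finrank_span_row]
    have : S = (Submodule.span ℂ (Set.range M.row)).map
        (WithLp.linearEquiv 2 ℂ (F → ℂ)).symm.toLinearMap := by
      rw [Submodule.map_span, ← Set.range_comp]
      rfl
    rw [this]
    exact LinearEquiv.finrank_map_eq _ _
  let q := stdOrthonormalBasis ℂ S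
  have hnorm : ∀ x : EuclideanSpace ℂ F, ‖S.orthogonalProjectionOnto x‖ ^ 2
      = ∑ l, ‖inner ℂ x (q l : EuclideanSpace ℂ F)‖ ^ 2 := by
    intro x
    rw [← q.sum_sq_norm_inner_left]
    refine Finset.sum_congr rfl fun l _ => ?_
    rw [Submodule.inner_orthogonalProjectionOnto_eq_of_mem_right]
  refine ⟨fun e => ‖S.orthogonalProjectionOnto (v e)‖ ^ 2, fun e => sq_nonneg _, fun e => ?_, ?_,
    fun e => ?_⟩
  · have h1 : ‖v e‖ ^ 2 ≤ 1 := by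
      rw [← inner_self_eq_norm_sq (𝕜 := ℂ), hvv]
      split_ifs <;> simp
    exact (pow_le_pow_left₀ (norm_nonneg _) (S.norm_orthogonalProjectionOnto_apply_le _) 2).trans h1
  · simp only [hnorm]
    rw [Finset.sum_comm, ← hS]
    have hon : Orthonormal ℂ (fun e : {e // y e ≠ 0} => v e) := by
      rw [orthonormal_iff_ite]
      rintro ⟨e, he⟩ ⟨e', he'⟩
      simp [hvv, he]
    calc ∑ l, ∑ e, ‖inner ℂ (v e) (q l : EuclideanSpace ℂ F)‖ ^ 2
        ≤ ∑ l : Fin (Module.finrank ℂ S), (1 : ℝ) := by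
          refine Finset.sum_le_sum fun l _ => ?_
          have h1 := hon.sum_inner_products_le (q l : EuclideanSpace ℂ F) (s := Finset.univ)
          have h2 : ‖(q l : EuclideanSpace ℂ F)‖ = 1 := q.orthonormal.1 l
          rw [h2, one_pow] at h1
          refine le_trans (le_of_eq ?_) h1
          rw [← Fintype.sum_subtype_add_sum_subtype (fun e => y e ≠ 0), add_eq_left]
          refine Finset.sum_eq_zero fun e _ => ?_
          rw [hv0 e (not_not.1 e.2), inner_zero_left]
          simp
      _ = _ := by simp
  · have hm : m e ∈ S := Submodule.subset_span ⟨e, rfl⟩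
    have h1 : (M * Wᴴ) e e = inner ℂ (w e) (m e) := (hinner W M e e).symm
    have h2 : inner ℂ (w e) (m e)
        = (√(y e) : ℂ) * inner ℂ (S.orthogonalProjectionOnto (v e)) (⟨m e, hm⟩ : S) := by
      rw [hwv, inner_smul_left, Complex.conj_ofReal]
      congr 1
      exact (Submodule.inner_orthogonalProjectionOnto_eq_of_mem_right ⟨m e, hm⟩ (v e)).symm
    have h3 : ((M * Mᴴ) e e).re = ‖m e‖ ^ 2 := by
      rw [← hinner, ← inner_self_eq_norm_sq (𝕜 := ℂ)]
      rfl
    rw [h1, h2, h3, norm_mul, mul_pow, Complex.norm_real, Real.norm_eq_abs, sq_abs,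
      Real.sq_sqrt (hy₀ e), mul_assoc, ← mul_pow]
    refine mul_le_mul_of_nonneg_left ?_ (hy₀ e)
    have h4 := norm_inner_le_norm (𝕜 := ℂ) (S.orthogonalProjectionOnto (v e)) (⟨m e, hm⟩ : S)
    exact pow_le_pow_left₀ (norm_nonneg _) h4 2

/-! ### Flattening a protocol into transcripts -/

open scoped ComplexOrder

theorem sum_kronecker {ι l m n p : Type*} (s : Finset ι) (A : ι → Matrix l m ℂ)
    (B : Matrix n p ℂ) : (∑ i ∈ s, A i) ⊗ₖ B = ∑ i ∈ s, A i ⊗ₖ B := by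
  ext
  simp [Matrix.sum_apply, Finset.sum_mul]

theorem kronecker_sum {ι l m n p : Type*} (s : Finset ι) (A : Matrix l m ℂ)
    (B : ι → Matrix n p ℂ) : A ⊗ₖ (∑ i ∈ s, B i) = ∑ i ∈ s, A ⊗ₖ B i := by
  ext
  simp [Matrix.sum_apply, Finset.mul_sum]

/-- A finite sum of product Kraus operators, grouped into finitely many transcripts `t`, such that
within a transcript the Kraus families of the two parties are contractions that are chosen
independently of each other. -/
structure SeparableForm (a' b' a b : ℕ) where
  /-- Transcripts. -/
  T : Type
  [fintypeT : Fintype T]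
  /-- Index set of Alice's Kraus operators. -/
  I : T → Type
  [fintypeI : ∀ t, Fintype (I t)]
  /-- Index set of Bob's Kraus operators. -/
  J : T → Type
  [fintypeJ : ∀ t, Fintype (J t)]
  /-- Alice's Kraus operators. -/
  A : ∀ t, I t → Matrix (Fin a') (Fin a) ℂ
  /-- Bob's Kraus operators. -/
  B : ∀ t, J t → Matrix (Fin b') (Fin b) ℂ
  posSemidef_A : ∀ t, (1 - ∑ i, (A t i)ᴴ * A t i).PosSemidef
  posSemidef_B : ∀ t, (1 - ∑ j, (B t j)ᴴ * B t j).PosSemidef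

attribute [instance] SeparableForm.fintypeT SeparableForm.fintypeI SeparableForm.fintypeJ

/-- The action of a separable form on an operator. -/
def SeparableForm.run {a' b' a b : ℕ} (S : SeparableForm a' b' a b) (ρ : BipartiteOp a b) :
    BipartiteOp a' b' :=
  ∑ t, ∑ i, ∑ j, (S.A t i ⊗ₖ S.B t j) * ρ * (S.A t i ⊗ₖ S.B t j)ᴴ

/-- The defect of the composition telescopes into the defect of `K` plus the defect of `A`
conjugated by each `K k`. -/
theorem posSemidef_one_sub_sum_comp {l m n : Type*} [Fintype l] [Fintype m] [DecidableEq m]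
    [Fintype n] [DecidableEq n] {ι κ : Type*} [Fintype ι] [Fintype κ]
    {A : ι → Matrix l m ℂ} {K : κ → Matrix m n ℂ}
    (hA : (1 - ∑ i, (A i)ᴴ * A i).PosSemidef) (hK : (1 - ∑ k, (K k)ᴴ * K k).PosSemidef) :
    (1 - ∑ x : κ × ι, (A x.2 * K x.1)ᴴ * (A x.2 * K x.1)).PosSemidef := by
  have h : 1 - ∑ x : κ × ι, (A x.2 * K x.1)ᴴ * (A x.2 * K x.1)
      = (1 - ∑ k, (K k)ᴴ * K k) + ∑ k, (K k)ᴴ * (1 - ∑ i, (A i)ᴴ * A i) * K k := by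
    simp only [Fintype.sum_prod_type, Matrix.mul_sub, Matrix.sub_mul, Matrix.mul_one,
      Finset.sum_sub_distrib, Matrix.conjTranspose_mul, Matrix.mul_sum, Matrix.sum_mul,
      Matrix.mul_assoc]
    abel
  rw [h]
  exact hK.add (Matrix.posSemidef_sum _ fun k _ => hA.conjTranspose_mul_mul_same _)

theorem Instrument.posSemidef_one_sub {a d : ℕ} {out : Fin d → ℕ} (I : Instrument a out)
    (m : Fin d) : (1 - ∑ k, (I.K m k)ᴴ * I.K m k).PosSemidef := by
  classical
  have h : 1 - ∑ k, (I.K m k)ᴴ * I.K m k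
      = ∑ m' ∈ Finset.univ.erase m, ∑ k, (I.K m' k)ᴴ * I.K m' k := by
    rw [← I.complete, ← Finset.add_sum_erase _ _ (Finset.mem_univ m), add_sub_cancel_left]
  rw [h]
  exact Matrix.posSemidef_sum _ fun m' _ => Matrix.posSemidef_sum _ fun k _ =>
    Matrix.posSemidef_conjTranspose_mul_self _

/-- The separable form of the trivial protocol. -/
def SeparableForm.done (a' b' : ℕ) : SeparableForm a' b' a' b' where
  T := Unit
  I _ := Unit
  J _ := Unit
  A _ _ := 1
  B _ _ := 1
  posSemidef_A _ := by simpa using Matrix.PosSemidef.zero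
  posSemidef_B _ := by simpa using Matrix.PosSemidef.zero

/-- The separable form after a preceding instrument of Alice. -/
def SeparableForm.alice {a' b' a b d : ℕ} {out : Fin d → ℕ} (I : Instrument a out)
    (S : ∀ m, SeparableForm a' b' (out m) b) : SeparableForm a' b' a b where
  T := Σ m, (S m).T
  I t := Fin (I.num t.1) × (S t.1).I t.2
  J t := (S t.1).J t.2
  A t x := (S t.1).A t.2 x.2 * I.K t.1 x.1
  B t j := (S t.1).B t.2 j
  posSemidef_A t := posSemidef_one_sub_sum_comp ((S t.1).posSemidef_A t.2) (I.posSemidef_one_sub t.1)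
  posSemidef_B t := (S t.1).posSemidef_B t.2

/-- The separable form after a preceding instrument of Bob. -/
def SeparableForm.bob {a' b' a b d : ℕ} {out : Fin d → ℕ} (I : Instrument b out)
    (S : ∀ m, SeparableForm a' b' a (out m)) : SeparableForm a' b' a b where
  T := Σ m, (S m).T
  I t := (S t.1).I t.2
  J t := Fin (I.num t.1) × (S t.1).J t.2
  A t i := (S t.1).A t.2 i
  B t x := (S t.1).B t.2 x.2 * I.K t.1 x.1
  posSemidef_A t := (S t.1).posSemidef_A t.2
  posSemidef_B t := posSemidef_one_sub_sum_comp ((S t.1).posSemidef_B t.2) (I.posSemidef_one_sub t.1)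

theorem SeparableForm.run_done {a' b' : ℕ} (ρ : BipartiteOp a' b') :
    (SeparableForm.done a' b').run ρ = ρ := by
  change ∑ _t : Unit, ∑ _i : Unit, ∑ _j : Unit,
    ((1 : Matrix (Fin a') (Fin a') ℂ) ⊗ₖ (1 : Matrix (Fin b') (Fin b') ℂ)) * ρ *
      ((1 : Matrix (Fin a') (Fin a') ℂ) ⊗ₖ (1 : Matrix (Fin b') (Fin b') ℂ))ᴴ = ρ
  simp

theorem SeparableForm.run_alice {a' b' a b d : ℕ} {out : Fin d → ℕ} (I : Instrument a out)
    (S : ∀ m, SeparableForm a' b' (out m) b) (ρ : BipartiteOp a b) :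
    (SeparableForm.alice I S).run ρ = ∑ m, (S m).run (∑ k,
      (I.K m k ⊗ₖ (1 : Matrix (Fin b) (Fin b) ℂ)) * ρ *
        (I.K m k ⊗ₖ (1 : Matrix (Fin b) (Fin b) ℂ))ᴴ) := by
  simp only [SeparableForm.run, Matrix.mul_sum, Matrix.sum_mul]
  refine (Fintype.sum_sigma _).trans (Finset.sum_congr rfl fun m _ =>
    Finset.sum_congr rfl fun t _ => (Fintype.sum_prod_type _).trans ?_)
  rw [Finset.sum_comm]
  refine Finset.sum_congr rfl fun i _ => ?_
  rw [Finset.sum_comm]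
  refine Finset.sum_congr rfl fun j _ => Finset.sum_congr rfl fun k _ => ?_
  have h : ((S m).A t i * I.K m k) ⊗ₖ (S m).B t j
      = ((S m).A t i ⊗ₖ (S m).B t j) * (I.K m k ⊗ₖ (1 : Matrix (Fin b) (Fin b) ℂ)) := by
    rw [← Matrix.mul_kronecker_mul, Matrix.mul_one]
  simp only [SeparableForm.alice]
  rw [h]
  simp only [Matrix.conjTranspose_mul, Matrix.mul_assoc]

theorem SeparableForm.run_bob {a' b' a b d : ℕ} {out : Fin d → ℕ} (I : Instrument b out)
    (S : ∀ m, SeparableForm a' b' a (out m)) (ρ : BipartiteOp a b) :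
    (SeparableForm.bob I S).run ρ = ∑ m, (S m).run (∑ k,
      ((1 : Matrix (Fin a) (Fin a) ℂ) ⊗ₖ I.K m k) * ρ *
        ((1 : Matrix (Fin a) (Fin a) ℂ) ⊗ₖ I.K m k)ᴴ) := by
  simp only [SeparableForm.run, Matrix.mul_sum, Matrix.sum_mul]
  refine (Fintype.sum_sigma _).trans (Finset.sum_congr rfl fun m _ =>
    Finset.sum_congr rfl fun t _ => Finset.sum_congr rfl fun i _ =>
      (Fintype.sum_prod_type _).trans ?_)
  rw [Finset.sum_comm]
  refine Finset.sum_congr rfl fun j _ => Finset.sum_congr rfl fun k _ => ?_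
  have h : (S m).A t i ⊗ₖ ((S m).B t j * I.K m k)
      = ((S m).A t i ⊗ₖ (S m).B t j) * ((1 : Matrix (Fin a) (Fin a) ℂ) ⊗ₖ I.K m k) := by
    rw [← Matrix.mul_kronecker_mul, Matrix.mul_one]
  simp only [SeparableForm.bob]
  rw [h]
  simp only [Matrix.conjTranspose_mul, Matrix.mul_assoc]

theorem sum_card_le_two_rpow {d : ℕ} (hd : 0 < d) (T : Fin d → Type) [∀ m, Fintype (T m)]
    (x : Fin d → ℝ) (h : ∀ m, (Fintype.card (T m) : ℝ) ≤ 2 ^ x m) :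
    (Fintype.card (Σ m, T m) : ℝ) ≤ 2 ^ (Real.logb 2 d + ⨆ m, x m) := by
  rw [Fintype.card_sigma, Nat.cast_sum, Real.rpow_add two_pos,
    Real.rpow_logb two_pos (by norm_num) (by exact_mod_cast hd)]
  calc ∑ m, (Fintype.card (T m) : ℝ) ≤ ∑ _m : Fin d, (2 : ℝ) ^ (⨆ m, x m) :=
        Finset.sum_le_sum fun m _ => (h m).trans (Real.rpow_le_rpow_of_exponent_le one_le_two
          (le_ciSup (Set.finite_range x).bddAbove m))
    _ = _ := by simp

/-- Only the announced outcome multiplies transcripts. The unannounced Kraus index is absorbed into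
the acting party's family, so it costs nothing in the count. -/
theorem LOCC.exists_separableForm {a' b' a b : ℕ} (P : LOCC a' b' a b) :
    ∃ S : SeparableForm a' b' a b, (Fintype.card S.T : ℝ) ≤ 2 ^ P.bits ∧
      ∀ ρ, P.run ρ = S.run ρ := by
  induction P with
  | done =>
    refine ⟨SeparableForm.done a' b', ?_, fun ρ => (SeparableForm.run_done ρ).symm⟩
    have : Fintype.card (SeparableForm.done a' b').T = 1 := Fintype.card_unit
    rw [this]
    simp [LOCC.bits]
  | alice d hd out I next ih =>
    choose S hS hrun using ih
    refine ⟨SeparableForm.alice I S, sum_card_le_two_rpow hd _ _ hS, fun ρ => ?_⟩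
    rw [SeparableForm.run_alice, LOCC.run]
    exact Finset.sum_congr rfl fun m _ => hrun m _
  | bob d hd out I next ih =>
    choose S hS hrun using ih
    refine ⟨SeparableForm.bob I S, sum_card_le_two_rpow hd _ _ hS, fun ρ => ?_⟩
    rw [SeparableForm.run_bob, LOCC.run]
    exact Finset.sum_congr rfl fun m _ => hrun m _

/-- A separable form records only contractivity per transcript; normalisation of the total has to
come from completeness of the instruments. -/
theorem LOCC.trace_run {a' b' a b : ℕ} (P : LOCC a' b' a b) (ρ : BipartiteOp a b) :
    (P.run ρ).trace = ρ.trace := by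
  induction P with
  | done => rfl
  | @alice a b d hd out I next ih =>
    rw [LOCC.run, Matrix.trace_sum]
    simp only [ih, Matrix.trace_sum]
    have h : ∀ m k, ((I.K m k ⊗ₖ (1 : Matrix (Fin b) (Fin b) ℂ)) * ρ *
        (I.K m k ⊗ₖ (1 : Matrix (Fin b) (Fin b) ℂ))ᴴ).trace
        = ((((I.K m k)ᴴ * I.K m k) ⊗ₖ (1 : Matrix (Fin b) (Fin b) ℂ)) * ρ).trace := by
      intro m k
      rw [Matrix.trace_mul_comm, ← Matrix.mul_assoc, Matrix.conjTranspose_kronecker,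
        ← Matrix.mul_kronecker_mul, Matrix.conjTranspose_one, Matrix.mul_one]
    simp only [h, ← Matrix.trace_sum, ← Matrix.sum_mul, ← sum_kronecker, I.complete,
      Matrix.one_kronecker_one, Matrix.one_mul]
  | @bob a b d hd out I next ih =>
    rw [LOCC.run, Matrix.trace_sum]
    simp only [ih, Matrix.trace_sum]
    have h : ∀ m k, (((1 : Matrix (Fin a) (Fin a) ℂ) ⊗ₖ I.K m k) * ρ *
        ((1 : Matrix (Fin a) (Fin a) ℂ) ⊗ₖ I.K m k)ᴴ).trace
        = (((1 : Matrix (Fin a) (Fin a) ℂ) ⊗ₖ ((I.K m k)ᴴ * I.K m k)) * ρ).trace := by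
      intro m k
      rw [Matrix.trace_mul_comm, ← Matrix.mul_assoc, Matrix.conjTranspose_kronecker,
        ← Matrix.mul_kronecker_mul, Matrix.conjTranspose_one, Matrix.mul_one]
    simp only [h, ← Matrix.trace_sum, ← Matrix.sum_mul, ← kronecker_sum, I.complete,
      Matrix.one_kronecker_one, Matrix.one_mul]

/-! ### Contractions and overlap weights -/

/-- Both defects are Schur complements of the block matrix with unit diagonal blocks and
off-diagonal blocks `V`, `Vᴴ`. -/
theorem posSemidef_one_sub_mul_conjTranspose {m n : Type*} [Fintype m] [DecidableEq m] [Fintype n]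
    [DecidableEq n] {V : Matrix m n ℂ} (hV : (1 - Vᴴ * V).PosSemidef) :
    (1 - V * Vᴴ).PosSemidef := by
  let _ : Invertible (1 : Matrix m m ℂ) := invertibleOne
  let _ : Invertible (1 : Matrix n n ℂ) := invertibleOne
  have h1 := Matrix.PosDef.fromBlocks₁₁ (A := (1 : Matrix m m ℂ)) V (1 : Matrix n n ℂ)
    Matrix.PosDef.one
  have h2 := Matrix.PosDef.fromBlocks₂₂ (1 : Matrix m m ℂ) V (D := (1 : Matrix n n ℂ))
    Matrix.PosDef.one
  rw [inv_one, Matrix.mul_one] at h1 h2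
  exact h2.1 (h1.2 hV)

/-- A family of matrices stacked on top of each other. -/
def stack {ι m n : Type*} (A : ι → Matrix m n ℂ) : Matrix (ι × m) n ℂ :=
  Matrix.of fun x y => A x.1 x.2 y

theorem conjTranspose_stack_mul_stack {ι m n : Type*} [Fintype ι] [Fintype m]
    (A : ι → Matrix m n ℂ) : (stack A)ᴴ * stack A = ∑ i, (A i)ᴴ * A i := by
  ext x y
  simp [Matrix.mul_apply, Matrix.sum_apply, stack, Fintype.sum_prod_type]

/-- Telescoping: the difference is `L (1 - V Vᴴ) + V (L - X Xᴴ) Vᴴ + (V X) (1 - Yᴴ Y)ᵀ (V X)ᴴ`. -/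
theorem posSemidef_smul_one_sub_sandwich {m n p q : Type*} [Fintype m] [DecidableEq m] [Fintype n]
    [DecidableEq n] [Fintype p] [DecidableEq p] [Fintype q] [DecidableEq q]
    {V : Matrix m n ℂ} {X : Matrix n p ℂ} {Y : Matrix q p ℂ} {L : ℝ} (hL : 0 ≤ L)
    (hV : (1 - Vᴴ * V).PosSemidef) (hY : (1 - Yᴴ * Y).PosSemidef)
    (hX : ((L : ℂ) • 1 - X * Xᴴ).PosSemidef) :
    ((L : ℂ) • 1 - (V * X * Yᵀ) * (V * X * Yᵀ)ᴴ).PosSemidef := by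
  have h1 := (posSemidef_one_sub_mul_conjTranspose hV).smul
    (show (0 : ℂ) ≤ (L : ℂ) by exact_mod_cast hL)
  have h2 := hX.mul_mul_conjTranspose_same V
  have h3 := hY.transpose.mul_mul_conjTranspose_same (V * X)
  have h := (h1.add h2).add h3
  convert h using 1
  rw [Matrix.transpose_sub, Matrix.transpose_mul, Matrix.transpose_one]
  have hYt : (Yᵀ)ᴴ = (Yᴴ)ᵀ := rfl
  simp only [Matrix.conjTranspose_mul, hYt, Matrix.mul_sub, Matrix.sub_mul, Matrix.mul_one,
    Matrix.mul_smul, Matrix.smul_mul, smul_sub, Matrix.mul_assoc]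
  abel

theorem conjTranspose_eigenvectorUnitary_mul_mul {n : Type*} [Fintype n] [DecidableEq n]
    {A : Matrix n n ℂ} (hA : A.IsHermitian) :
    (hA.eigenvectorUnitary : Matrix n n ℂ)ᴴ * A * (hA.eigenvectorUnitary : Matrix n n ℂ)
      = Matrix.diagonal (fun i => (hA.eigenvalues i : ℂ)) := by
  have := hA.conjStarAlgAut_star_eigenvectorUnitary
  rwa [Unitary.conjStarAlgAut_star_apply] at this

theorem exists_weights_of_diagonalization {E F : Type*} [Fintype E] [DecidableEq E] [Fintype F]
    (M W : Matrix E F ℂ) (U : Matrix E E ℂ) (hU : U * Uᴴ = 1) (y : E → ℝ)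
    (hW : Uᴴ * (W * Wᴴ) * U = Matrix.diagonal fun e => (y e : ℂ)) {L : ℝ}
    (hM : ((L : ℂ) • 1 - M * Mᴴ).PosSemidef) :
    ∃ x p ν : E → ℝ, (∀ e, 0 ≤ p e) ∧ (∀ e, p e ≤ 1) ∧ ∑ e, p e ≤ M.rank ∧
      (∀ e, 0 ≤ ν e) ∧ (∀ e, ν e ≤ L) ∧ ∑ e, ν e = (M * Mᴴ).trace.re ∧
      (∀ e, x e ≤ √(y e * p e * ν e)) ∧ ∑ e, x e = (M * Wᴴ).trace.re := by
  have hU' : Uᴴ * U = 1 := mul_eq_one_comm.1 hU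
  have hmul : ∀ A : Matrix E F ℂ, (Uᴴ * M) * (Uᴴ * A)ᴴ = Uᴴ * (M * Aᴴ) * U := fun A => by
    rw [Matrix.conjTranspose_mul, Matrix.conjTranspose_conjTranspose]
    simp only [Matrix.mul_assoc]
  have htrace : ∀ A : Matrix E E ℂ, ∑ e, ((Uᴴ * A * U) e e).re = A.trace.re := fun A => by
    rw [← Complex.re_sum]
    change (Matrix.trace (Uᴴ * A * U)).re = _
    rw [Matrix.trace_mul_comm, ← Matrix.mul_assoc, hU, Matrix.one_mul]
  have hW' : (Uᴴ * W) * (Uᴴ * W)ᴴ = Matrix.diagonal fun e => (y e : ℂ) := by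
    rw [← hW, Matrix.conjTranspose_mul, Matrix.conjTranspose_conjTranspose]
    simp only [Matrix.mul_assoc]
  obtain ⟨p, hp₀, hp₁, hpR, hp⟩ := exists_row_weights (Uᴴ * M) (Uᴴ * W) y hW'
  have hpsd := hM.conjTranspose_mul_mul_same U
  rw [Matrix.mul_sub, Matrix.sub_mul, Matrix.mul_smul, Matrix.mul_one, Matrix.smul_mul, hU',
    ← hmul] at hpsd
  refine ⟨fun e => (((Uᴴ * M) * (Uᴴ * W)ᴴ) e e).re, p,
    fun e => (((Uᴴ * M) * (Uᴴ * M)ᴴ) e e).re, hp₀, hp₁,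
    hpR.trans (Nat.cast_le.2 (Matrix.rank_mul_le_right Uᴴ M)), fun e => ?_, fun e => ?_, ?_,
    fun e => ?_, ?_⟩
  · have h := (Matrix.posSemidef_self_mul_conjTranspose (Uᴴ * M)).diag_nonneg (i := e)
    exact (Complex.nonneg_iff.1 h).1
  · have h := (Complex.le_def.1 (hpsd.diag_nonneg (i := e))).1
    simp only [Matrix.sub_apply, Matrix.smul_apply, Matrix.one_apply_eq, smul_eq_mul, mul_one,
      Complex.sub_re, Complex.ofReal_re, Complex.zero_re] at h
    linarith
  · simp only [hmul, htrace]
  · refine (le_abs_self _).trans (Real.abs_le_sqrt (le_trans ?_ (hp e)))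
    rw [← sq_abs]
    exact pow_le_pow_left₀ (abs_nonneg _) (Complex.abs_re_le_norm _) 2
  · simp only [hmul, htrace]

/-- The comparison matrix is `W = χ ⊗ Ψ`, with `χ i j` the overlap of block `(i, j)` of `M` with
`Ψ`. The product structure gives `W Wᴴ` the eigenvalues `c k * r j`, and this choice of `χ` makes
`tr (M Wᴴ) = ∑ |χ i j|² = ∑ c`. -/
theorem exists_overlap_weights {I J m n : Type*} [Fintype I] [Fintype J] [Fintype m]
    [DecidableEq m] [DecidableEq I] [Fintype n] (M : Matrix (I × m) (J × n) ℂ) (Ψ : Matrix m n ℂ)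
    {ρ : Matrix m m ℂ} (hρ : ρ.IsHermitian) (hρΨ : ρ = Ψ * Ψᴴ) {L : ℝ}
    (hM : ((L : ℂ) • 1 - M * Mᴴ).PosSemidef) :
    ∃ (c : I → ℝ) (x p ν : I → m → ℝ), (∀ k, 0 ≤ c k) ∧
      ∑ k, c k = ∑ i, ∑ j, ‖∑ α, ∑ β, star (Ψ α β) * M (i, α) (j, β)‖ ^ 2 ∧
      (∀ k j, 0 ≤ p k j) ∧ (∀ k j, p k j ≤ 1) ∧ ∑ k, ∑ j, p k j ≤ M.rank ∧
      (∀ k j, 0 ≤ ν k j) ∧ (∀ k j, ν k j ≤ L) ∧ ∑ k, ∑ j, ν k j = (M * Mᴴ).trace.re ∧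
      (∀ k j, x k j ≤ √(c k * hρ.eigenvalues j * p k j * ν k j)) ∧
      ∑ k, ∑ j, x k j = ∑ k, c k := by
  obtain ⟨χ, hχ⟩ : ∃ χ : Matrix I J ℂ,
      ∀ i j, χ i j = ∑ α, ∑ β, star (Ψ α β) * M (i, α) (j, β) := ⟨Matrix.of _, fun _ _ => rfl⟩
  have hH := Matrix.isHermitian_mul_conjTranspose_self χ
  have hdiag : ((hH.eigenvectorUnitary : Matrix I I ℂ) ⊗ₖ (hρ.eigenvectorUnitary : Matrix m m ℂ))ᴴ
      * ((χ ⊗ₖ Ψ) * (χ ⊗ₖ Ψ)ᴴ)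
      * ((hH.eigenvectorUnitary : Matrix I I ℂ) ⊗ₖ (hρ.eigenvectorUnitary : Matrix m m ℂ))
      = Matrix.diagonal fun e : I × m => ((hH.eigenvalues e.1 * hρ.eigenvalues e.2 : ℝ) : ℂ) := by
    rw [Matrix.conjTranspose_kronecker, Matrix.conjTranspose_kronecker,
      ← Matrix.mul_kronecker_mul, ← Matrix.mul_kronecker_mul, ← Matrix.mul_kronecker_mul, ← hρΨ,
      conjTranspose_eigenvectorUnitary_mul_mul hH, conjTranspose_eigenvectorUnitary_mul_mul hρ,
      Matrix.diagonal_kronecker_diagonal]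
    simp
  have hunit : ((hH.eigenvectorUnitary : Matrix I I ℂ) ⊗ₖ (hρ.eigenvectorUnitary : Matrix m m ℂ))
      * ((hH.eigenvectorUnitary : Matrix I I ℂ) ⊗ₖ (hρ.eigenvectorUnitary : Matrix m m ℂ))ᴴ
      = 1 := by
    have h1 : (hH.eigenvectorUnitary : Matrix I I ℂ) * (hH.eigenvectorUnitary : Matrix I I ℂ)ᴴ = 1 :=
      Unitary.coe_mul_star_self _
    have h2 : (hρ.eigenvectorUnitary : Matrix m m ℂ) * (hρ.eigenvectorUnitary : Matrix m m ℂ)ᴴ = 1 :=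
      Unitary.coe_mul_star_self _
    rw [Matrix.conjTranspose_kronecker, ← Matrix.mul_kronecker_mul, h1, h2,
      Matrix.one_kronecker_one]
  have hMW : (M * (χ ⊗ₖ Ψ)ᴴ).trace = ((∑ i, ∑ j, ‖χ i j‖ ^ 2 : ℝ) : ℂ) := by
    simp only [Matrix.trace, Matrix.diag, Matrix.mul_apply, Matrix.conjTranspose_apply,
      Fintype.sum_prod_type, Matrix.kronecker_apply]
    push_cast
    refine Finset.sum_congr rfl fun i _ => ?_
    rw [Finset.sum_comm]
    refine Finset.sum_congr rfl fun j _ => ?_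
    rw [← Complex.conj_mul', ← Complex.star_def]
    -- Only the unconjugated factor of `|χ i j|²` is expanded.
    nth_rewrite 3 [hχ]
    rw [Finset.mul_sum]
    refine Finset.sum_congr rfl fun α _ => ?_
    rw [Finset.mul_sum]
    refine Finset.sum_congr rfl fun β _ => ?_
    rw [star_mul']
    ring
  have hcsum : ∑ k, hH.eigenvalues k = ∑ i, ∑ j, ‖χ i j‖ ^ 2 := by
    have h := hH.trace_eq_sum_eigenvalues
    have h2 : (χ * χᴴ).trace = ((∑ i, ∑ j, ‖χ i j‖ ^ 2 : ℝ) : ℂ) := by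
      simp only [Matrix.trace, Matrix.diag, Matrix.mul_apply, Matrix.conjTranspose_apply]
      push_cast
      simp only [← Complex.mul_conj', ← Complex.star_def]
    rw [h2] at h
    exact Complex.ofReal_injective (by rw [h]; push_cast; rfl)
  obtain ⟨x, p, ν, hp₀, hp₁, hpR, hν₀, hν₁, hν, hx, hxs⟩ :=
    exists_weights_of_diagonalization M (χ ⊗ₖ Ψ) _ hunit _ hdiag hM
  refine ⟨hH.eigenvalues, fun k j => x (k, j), fun k j => p (k, j), fun k j => ν (k, j),
    (Matrix.posSemidef_self_mul_conjTranspose χ).eigenvalues_nonneg, ?_, fun k j => hp₀ _,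
    fun k j => hp₁ _, ?_, fun k j => hν₀ _, fun k j => hν₁ _, ?_, fun k j => hx _, ?_⟩
  · simp only [hcsum, hχ]
  · rwa [← Fintype.sum_prod_type]
  · rwa [← Fintype.sum_prod_type]
  · rw [← Fintype.sum_prod_type, hxs, hMW, hcsum, Complex.ofReal_re]

/-! ### Pure states, fidelity and transcript matrices -/

/-- The coefficients of a bipartite vector, arranged as a matrix. -/
def coeffMatrix {a b : ℕ} (φ : EuclideanSpace ℂ (Fin a × Fin b)) : Matrix (Fin a) (Fin b) ℂ :=
  Matrix.of fun i j => φ (i, j)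

theorem traceB_pureDensity {a b : ℕ} (φ : EuclideanSpace ℂ (Fin a × Fin b)) :
    traceB (pureDensity φ) = coeffMatrix φ * (coeffMatrix φ)ᴴ := by
  ext i j
  simp [traceB, pureDensity, coeffMatrix, Matrix.mul_apply]

theorem pureDensity_eq_vecMulVec {a b : ℕ} (φ : EuclideanSpace ℂ (Fin a × Fin b)) :
    pureDensity φ = Matrix.vecMulVec φ.ofLp (star φ.ofLp) := rfl

theorem star_dotProduct_self_eq_one {ι : Type*} [Fintype ι] {v : EuclideanSpace ℂ ι}
    (hv : ‖v‖ = 1) : star v.ofLp ⬝ᵥ v.ofLp = 1 := by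
  rw [dotProduct_comm, ← EuclideanSpace.inner_eq_star_dotProduct, inner_self_eq_norm_sq_to_K, hv]
  simp

theorem trace_pureDensity {a b : ℕ} {φ : EuclideanSpace ℂ (Fin a × Fin b)} (hφ : ‖φ‖ = 1) :
    (pureDensity φ).trace = 1 := by
  rw [pureDensity_eq_vecMulVec, Matrix.trace_vecMulVec, dotProduct_comm,
    star_dotProduct_self_eq_one hφ]

theorem trace_traceB {a b : ℕ} (ρ : BipartiteOp a b) : (traceB ρ).trace = ρ.trace := by
  simp [traceB, Matrix.trace, Fintype.sum_prod_type]

theorem sum_eigenvalues_traceB {a b : ℕ} {φ : EuclideanSpace ℂ (Fin a × Fin b)} (hφ : ‖φ‖ = 1) :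
    ∑ i, (isHermitian_traceB_pureDensity φ).eigenvalues i = 1 := by
  have h := (isHermitian_traceB_pureDensity φ).trace_eq_sum_eigenvalues
  rw [trace_traceB, trace_pureDensity hφ] at h
  exact Complex.ofReal_injective (by rw [Complex.ofReal_one, h]; push_cast; rfl)

theorem eigenvalues_traceB_nonneg {a b : ℕ} (φ : EuclideanSpace ℂ (Fin a × Fin b)) (i : Fin a) :
    0 ≤ (isHermitian_traceB_pureDensity φ).eigenvalues i := by
  have h : (traceB (pureDensity φ)).PosSemidef :=
    traceB_pureDensity φ ▸ Matrix.posSemidef_self_mul_conjTranspose (coeffMatrix φ)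
  exact h.eigenvalues_nonneg i

open scoped MatrixOrder in
-- A rank-one projection is its own square root, and it compresses `ω` to the multiple `⟨ψ|ω|ψ⟩` of
-- itself.
theorem fidelity_pureDensity {a b : ℕ} {ψ : EuclideanSpace ℂ (Fin a × Fin b)} (hψ : ‖ψ‖ = 1)
    {ω : BipartiteOp a b} (hω : ω.PosSemidef) :
    fidelity (pureDensity ψ) ω = (star ψ.ofLp ⬝ᵥ ω *ᵥ ψ.ofLp).re := by
  have hpsd : (pureDensity ψ).PosSemidef := Matrix.posSemidef_vecMulVec_self_star _
  have hq := hω.dotProduct_mulVec_nonneg ψ.ofLp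
  set q : ℂ := star ψ.ofLp ⬝ᵥ ω *ᵥ ψ.ofLp with hqdef
  obtain ⟨hq₀, hqi⟩ := Complex.nonneg_iff.1 hq
  have hqr : q = (q.re : ℂ) := Complex.ext rfl hqi.symm
  have hidem : pureDensity ψ * pureDensity ψ = pureDensity ψ := by
    rw [pureDensity_eq_vecMulVec, Matrix.vecMulVec_mul_vecMulVec, star_dotProduct_self_eq_one hψ,
      one_smul]
  have hsand : pureDensity ψ * ω * pureDensity ψ = q • pureDensity ψ := by
    rw [pureDensity_eq_vecMulVec, Matrix.vecMulVec_mul, Matrix.vecMulVec_mul_vecMulVec,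
      ← Matrix.dotProduct_mulVec, ← hqdef]
    ext i j
    simp only [Matrix.vecMulVec_apply, Matrix.smul_apply, Pi.smul_apply, smul_eq_mul, Pi.star_apply]
    ring
  have hs1 : CFC.sqrt (pureDensity ψ) = pureDensity ψ :=
    CFC.sqrt_unique hidem (Matrix.nonneg_iff_posSemidef.2 hpsd)
  have hs2 : CFC.sqrt (q • pureDensity ψ) = ((√q.re : ℝ) : ℂ) • pureDensity ψ := by
    refine CFC.sqrt_unique ?_ (Matrix.nonneg_iff_posSemidef.2 (hpsd.smul ?_))
    · rw [Matrix.smul_mul, Matrix.mul_smul, hidem, smul_smul, ← Complex.ofReal_mul,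
        Real.mul_self_sqrt hq₀, ← hqr]
    · exact_mod_cast Real.sqrt_nonneg _
  rw [fidelity, hs1, hsand, hs2, Matrix.trace_smul, trace_pureDensity hψ, smul_eq_mul, mul_one,
    Complex.ofReal_re, Real.sq_sqrt hq₀]

theorem kronecker_mulVec_apply {a b a' b' : ℕ} (A : Matrix (Fin a') (Fin a) ℂ)
    (B : Matrix (Fin b') (Fin b) ℂ) (φ : EuclideanSpace ℂ (Fin a × Fin b)) (x : Fin a')
    (y : Fin b') : ((A ⊗ₖ B) *ᵥ φ.ofLp) (x, y) = (A * coeffMatrix φ * Bᵀ) x y := by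
  simp only [Matrix.mulVec, dotProduct, Fintype.sum_prod_type, Matrix.kronecker_apply,
    Matrix.mul_apply, Matrix.transpose_apply, coeffMatrix, Matrix.of_apply, Finset.sum_mul]
  rw [Finset.sum_comm]
  exact Finset.sum_congr rfl fun j _ => Finset.sum_congr rfl fun i _ => by ring

theorem sandwich_pureDensity {a b : ℕ} {n : Type*} [Fintype n] (φ : EuclideanSpace ℂ (Fin a × Fin b))
    (C : Matrix n (Fin a × Fin b) ℂ) :
    C * pureDensity φ * Cᴴ = Matrix.vecMulVec (C *ᵥ φ.ofLp) (star (C *ᵥ φ.ofLp)) := by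
  rw [pureDensity_eq_vecMulVec, Matrix.mul_vecMulVec, Matrix.vecMulVec_mul, Matrix.star_mulVec]

theorem star_dotProduct_vecMulVec_mulVec {n : Type*} [Fintype n] (v w : n → ℂ) :
    star v ⬝ᵥ Matrix.vecMulVec w (star w) *ᵥ v = ((‖star v ⬝ᵥ w‖ ^ 2 : ℝ) : ℂ) := by
  push_cast
  rw [← Complex.mul_conj', ← Complex.star_def, ← Matrix.star_dotProduct, Matrix.vecMulVec_mulVec]
  simp [dotProduct_smul, mul_comm]

/-- The unnormalised final state of a transcript, as a matrix from Bob to Alice, where the indices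
of the Kraus operators are kept as additional subsystems. -/
def SeparableForm.transcriptMatrix {a' b' a b : ℕ} (S : SeparableForm a' b' a b)
    (φ : EuclideanSpace ℂ (Fin a × Fin b)) (t : S.T) :
    Matrix (S.I t × Fin a') (S.J t × Fin b') ℂ :=
  stack (S.A t) * coeffMatrix φ * (stack (S.B t))ᵀ

theorem SeparableForm.posSemidef_run {a' b' a b : ℕ} (S : SeparableForm a' b' a b)
    (φ : EuclideanSpace ℂ (Fin a × Fin b)) : (S.run (pureDensity φ)).PosSemidef :=
  Matrix.posSemidef_sum _ fun _ _ => Matrix.posSemidef_sum _ fun _ _ =>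
    Matrix.posSemidef_sum _ fun _ _ =>
      (Matrix.posSemidef_vecMulVec_self_star φ.ofLp).mul_mul_conjTranspose_same _

theorem SeparableForm.expectation_run {a' b' a b : ℕ} (S : SeparableForm a' b' a b)
    (φ : EuclideanSpace ℂ (Fin a × Fin b)) (ψ : EuclideanSpace ℂ (Fin a' × Fin b')) :
    (star ψ.ofLp ⬝ᵥ S.run (pureDensity φ) *ᵥ ψ.ofLp).re
      = ∑ t, ∑ i, ∑ j, ‖∑ α, ∑ β, star (coeffMatrix ψ α β) *
          S.transcriptMatrix φ t (i, α) (j, β)‖ ^ 2 := by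
  simp only [SeparableForm.run, Matrix.sum_mulVec, dotProduct_sum, Complex.re_sum,
    sandwich_pureDensity, star_dotProduct_vecMulVec_mulVec, Complex.ofReal_re]
  refine Finset.sum_congr rfl fun t _ => Finset.sum_congr rfl fun i _ =>
    Finset.sum_congr rfl fun j _ => ?_
  rw [dotProduct, Fintype.sum_prod_type]
  simp only [kronecker_mulVec_apply]
  rfl

theorem SeparableForm.trace_run {a' b' a b : ℕ} (S : SeparableForm a' b' a b)
    (φ : EuclideanSpace ℂ (Fin a × Fin b)) :
    (S.run (pureDensity φ)).trace
      = ∑ t, (S.transcriptMatrix φ t * (S.transcriptMatrix φ t)ᴴ).trace := by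
  simp only [SeparableForm.run, Matrix.trace_sum, sandwich_pureDensity]
  refine Finset.sum_congr rfl fun t _ => ?_
  simp only [Matrix.trace, Matrix.diag, Matrix.mul_apply, Fintype.sum_prod_type,
    Matrix.vecMulVec_apply, Pi.star_apply, kronecker_mulVec_apply, Matrix.conjTranspose_apply]
  refine Finset.sum_congr rfl fun i _ => ?_
  rw [Finset.sum_comm]
  rfl

theorem LOCC.exists_smoothing_set {a b a' b' : ℕ} {φ : EuclideanSpace ℂ (Fin a × Fin b)}
    (hφ : ‖φ‖ = 1) {ψ : EuclideanSpace ℂ (Fin a' × Fin b')} (hψ : ‖ψ‖ = 1) {ε δ L : ℝ}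
    (hδ₀ : 0 < δ) (hδ₁ : δ < 1) (hεδ : 4 * ε = δ ^ 8) (P : LOCC a' b' a b)
    (hF : 1 - ε ≤ fidelity (pureDensity ψ) (P.run (pureDensity φ))) {R : ℕ} (hR₀ : 0 < R)
    (hR : (coeffMatrix φ).rank ≤ R) (hL₀ : 0 < L)
    (hL : ((L : ℂ) • 1 - coeffMatrix φ * (coeffMatrix φ)ᴴ).PosSemidef) :
    ∃ (J : Finset (Fin a')) (hJ : J.Nonempty),
      1 - δ ≤ ∑ j ∈ J, (isHermitian_traceB_pureDensity ψ).eigenvalues j ∧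
      (J.card : ℝ) * J.sup' hJ (isHermitian_traceB_pureDensity ψ).eigenvalues
        ≤ 2 ^ P.bits * R * L / (1 - δ) ^ 2 := by
  classical
  obtain ⟨S, hcard, hrun⟩ := P.exists_separableForm
  rw [hrun, fidelity_pureDensity hψ (S.posSemidef_run φ), S.expectation_run] at hF
  have htr : ∑ t, (S.transcriptMatrix φ t * (S.transcriptMatrix φ t)ᴴ).trace.re = 1 := by
    rw [← Complex.re_sum, ← S.trace_run, ← hrun, P.trace_run, trace_pureDensity hφ,
      Complex.one_re]
  have hrank : ∀ t, (S.transcriptMatrix φ t).rank ≤ R := fun t =>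
    ((Matrix.rank_mul_le_left _ _).trans (Matrix.rank_mul_le_right _ _)).trans hR
  have hbound : ∀ t, ((L : ℂ) • 1 - S.transcriptMatrix φ t * (S.transcriptMatrix φ t)ᴴ).PosSemidef :=
    fun t => posSemidef_smul_one_sub_sandwich hL₀.le
      (by rw [conjTranspose_stack_mul_stack]; exact S.posSemidef_A t)
      (by rw [conjTranspose_stack_mul_stack]; exact S.posSemidef_B t) hL
  choose c x p ν hc hcs hp₀ hp₁ hp hν₀ hν₁ hν hx hxs using fun t =>
    exists_overlap_weights (S.transcriptMatrix φ t) (coeffMatrix ψ)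
      (isHermitian_traceB_pureDensity ψ) (traceB_pureDensity ψ) (hbound t)
  -- All transcripts are pooled into one index `k = (t, i)`; each contributes at most `R` to the
  -- total of `p`, whence `B = 2 ^ P.bits * R`.
  refine EntanglementCost.exists_smoothing_set (K := Σ t, S.I t) (fun k => c k.1 k.2)
    (isHermitian_traceB_pureDensity ψ).eigenvalues (fun k => x k.1 k.2) (fun k => p k.1 k.2)
    (fun k => ν k.1 k.2) hδ₀ hδ₁ hεδ (by positivity) hL₀ (fun k => hc _ _)
    (eigenvalues_traceB_nonneg ψ) (sum_eigenvalues_traceB hψ) ?_ (fun k => hp₀ _ _)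
    (fun k => hp₁ _ _) ?_ (fun k => hν₀ _ _) (fun k => hν₁ _ _) ?_ (fun k => hx _ _) ?_
  · rw [Fintype.sum_sigma]
    simpa only [hcs] using hF
  · rw [Fintype.sum_sigma]
    calc ∑ t, ∑ i, ∑ j, p t i j ≤ ∑ _t : S.T, (R : ℝ) :=
          Finset.sum_le_sum fun t _ => (hp t).trans (Nat.cast_le.2 (hrank t))
      _ = Fintype.card S.T * R := by simp
      _ ≤ 2 ^ P.bits * R := mul_le_mul_of_nonneg_right hcard (Nat.cast_nonneg _)
  · rw [Fintype.sum_sigma]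
    simp only [hν, htr, le_refl]
  · rw [Fintype.sum_sigma, Fintype.sum_sigma]
    exact Finset.sum_congr rfl fun t _ => hxs t

/-! ### The smoothed quantity `Δ` and the final bound -/

theorem sum_le_card_mul_sup' {n : Type*} (r : n → ℝ) {J : Finset n} (hJ : J.Nonempty) :
    ∑ j ∈ J, r j ≤ J.card * J.sup' hJ r := by
  rw [← nsmul_eq_mul]
  exact Finset.sum_le_card_nsmul J r _ fun j hj => Finset.le_sup' r hj

theorem le_smoothDelta_of_forall {n : Type*} [Fintype n] [DecidableEq n] {ρ : Matrix n n ℂ}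
    (hρ : ρ.IsHermitian) (hsum : ∑ j, hρ.eigenvalues j = 1) {δ y : ℝ} (hδ : 0 ≤ δ) (hy : 0 < y)
    (h : ∀ (J : Finset n) (hJ : J.Nonempty), 1 - δ ≤ ∑ j ∈ J, hρ.eigenvalues j →
      y ≤ J.card * J.sup' hJ hρ.eigenvalues) :
    Real.logb 2 y ≤ smoothDelta hρ δ := by
  refine Real.logb_le_logb_of_le one_lt_two hy (le_csInf ?_ ?_)
  · have hne : (Finset.univ : Finset n).Nonempty := by
      by_contra hne
      rw [Finset.not_nonempty_iff_eq_empty] at hne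
      rw [hne, Finset.sum_empty] at hsum
      exact zero_ne_one hsum
    exact ⟨_, Finset.univ, hne, by rw [hsum]; linarith, rfl⟩
  · rintro x ⟨J, hJ, hJδ, rfl⟩
    exact h J hJ hJδ

theorem smoothDelta_le_logb {n : Type*} [Fintype n] [DecidableEq n] {ρ : Matrix n n ℂ}
    (hρ : ρ.IsHermitian) {δ y : ℝ} (hδ : δ < 1) {J : Finset n} (hJ : J.Nonempty)
    (hJδ : 1 - δ ≤ ∑ j ∈ J, hρ.eigenvalues j) (hy : J.card * J.sup' hJ hρ.eigenvalues ≤ y) :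
    smoothDelta hρ δ ≤ Real.logb 2 y := by
  have hlow : ∀ x ∈ {x : ℝ | ∃ (J : Finset n) (hJ : J.Nonempty),
      1 - δ ≤ ∑ j ∈ J, hρ.eigenvalues j ∧ x = (J.card : ℝ) * J.sup' hJ hρ.eigenvalues},
      1 - δ ≤ x := by
    rintro x ⟨J, hJ, hJδ, rfl⟩
    exact hJδ.trans (sum_le_card_mul_sup' _ hJ)
  refine Real.logb_le_logb_of_le one_lt_two ?_ ((csInf_le ⟨1 - δ, hlow⟩ ⟨J, hJ, hJδ, rfl⟩).trans hy)
  exact (sub_pos.2 hδ).trans_le (le_csInf ⟨_, J, hJ, hJδ, rfl⟩ hlow)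

open Filter Topology in
-- Finitely many index sets compete, and admissibility of each is constant for small positive `δ`.
-- This settles `ε = 0`.
theorem eventually_smoothDelta_eq {n : Type*} [Fintype n] [DecidableEq n] {ρ : Matrix n n ℂ}
    (hρ : ρ.IsHermitian) : ∀ᶠ δ in 𝓝[>] (0 : ℝ), smoothDelta hρ δ = smoothDelta hρ 0 := by
  have h : ∀ᶠ δ in 𝓝[>] (0 : ℝ), ∀ J : Finset n,
      (1 - δ ≤ ∑ j ∈ J, hρ.eigenvalues j ↔ 1 - 0 ≤ ∑ j ∈ J, hρ.eigenvalues j) := by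
    rw [eventually_all]
    intro J
    by_cases hJ : 1 - 0 ≤ ∑ j ∈ J, hρ.eigenvalues j
    · filter_upwards [self_mem_nhdsWithin] with δ (hδ : 0 < δ)
      exact ⟨fun _ => hJ, fun _ => by linarith⟩
    · have hpos : 0 < 1 - ∑ j ∈ J, hρ.eigenvalues j := by linarith [not_le.1 hJ]
      filter_upwards [Ioo_mem_nhdsGT hpos] with δ hδ
      exact ⟨fun h => absurd h (by linarith [hδ.2]), fun h => absurd h hJ⟩
  filter_upwards [h] with δ hδ
  simp only [smoothDelta, hδ]

theorem posSemidef_smul_one_sub_of_eigenvalues_le {n : Type*} [Fintype n] [DecidableEq n]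
    {ρ : Matrix n n ℂ} (hρ : ρ.IsHermitian) {L : ℝ} (h : ∀ i, hρ.eigenvalues i ≤ L) :
    ((L : ℂ) • 1 - ρ).PosSemidef := by
  have hU : (hρ.eigenvectorUnitary : Matrix n n ℂ) * (hρ.eigenvectorUnitary : Matrix n n ℂ)ᴴ = 1 :=
    Unitary.coe_mul_star_self _
  have hd : (Matrix.diagonal fun i => ((L - hρ.eigenvalues i : ℝ) : ℂ)).PosSemidef :=
    Matrix.posSemidef_diagonal_iff.2 fun i => by exact_mod_cast sub_nonneg.2 (h i)
  convert hd.mul_mul_conjTranspose_same (hρ.eigenvectorUnitary : Matrix n n ℂ) using 1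
  have h1 : (Matrix.diagonal fun i => ((L - hρ.eigenvalues i : ℝ) : ℂ))
      = (L : ℂ) • 1 - (hρ.eigenvectorUnitary : Matrix n n ℂ)ᴴ * ρ *
        (hρ.eigenvectorUnitary : Matrix n n ℂ) := by
    rw [conjTranspose_eigenvectorUnitary_mul_mul, Matrix.smul_one_eq_diagonal,
      Matrix.diagonal_sub]
    simp
  rw [h1, Matrix.mul_sub, Matrix.sub_mul, Matrix.mul_smul, Matrix.mul_one, Matrix.smul_mul, hU]
  congr 1
  rw [Matrix.mul_assoc, Matrix.mul_assoc, Matrix.mul_assoc, hU, Matrix.mul_one,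
    ← Matrix.mul_assoc, hU, Matrix.one_mul]

/-- The communication bound, for a positive smoothing parameter. -/
theorem LOCC.entanglementDelta_le {a b a' b' : ℕ} {φ : EuclideanSpace ℂ (Fin a × Fin b)}
    (hφ : ‖φ‖ = 1) {ψ : EuclideanSpace ℂ (Fin a' × Fin b')} (hψ : ‖ψ‖ = 1) {ε δ : ℝ}
    (hδ₀ : 0 < δ) (hδ₁ : δ < 1) (hεδ : 4 * ε = δ ^ 8) (P : LOCC a' b' a b)
    (hF : 1 - ε ≤ fidelity (pureDensity ψ) (P.run (pureDensity φ))) :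
    entanglementDelta δ ψ + 2 * Real.logb 2 (1 - δ) - P.bits ≤ entanglementDelta 0 φ := by
  have h1δ : 0 < 1 - δ := sub_pos.2 hδ₁
  have hsum := sum_eigenvalues_traceB hφ
  have hlog : entanglementDelta δ ψ + 2 * Real.logb 2 (1 - δ) - P.bits
      = Real.logb 2 (2 ^ (entanglementDelta δ ψ) * (1 - δ) ^ 2 / 2 ^ P.bits) := by
    rw [Real.logb_div (by positivity) (by positivity), Real.logb_mul (by positivity) (by positivity),
      Real.logb_rpow two_pos (by norm_num), Real.logb_rpow two_pos (by norm_num), Real.logb_pow]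
    norm_num
  rw [hlog]
  -- No minimiser for `φ` is needed: a set `J` of full mass contains all nonzero eigenvalues, so
  -- `J.card` and the maximum over `J` serve as `R` and `L`.
  refine le_smoothDelta_of_forall (isHermitian_traceB_pureDensity φ) hsum le_rfl (by positivity)
    fun J hJ hJ1 => ?_
  set r := (isHermitian_traceB_pureDensity φ).eigenvalues with hr
  rw [sub_zero] at hJ1
  have hcard : (0 : ℝ) < J.card := by exact_mod_cast hJ.card_pos
  have hsup : 0 < J.sup' hJ r := by
    have := hJ1.trans (sum_le_card_mul_sup' r hJ)
    exact pos_of_mul_pos_right (one_pos.trans_le this) hcard.le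
  have hout : ∀ i, i ∉ J → r i = 0 := by
    intro i hi
    have h1 : r i + ∑ j ∈ J, r j ≤ 1 := by
      rw [← Finset.sum_insert hi, ← hsum]
      exact Finset.sum_le_sum_of_subset_of_nonneg (Finset.subset_univ _)
        fun j _ _ => eigenvalues_traceB_nonneg φ j
    exact le_antisymm (by linarith) (eigenvalues_traceB_nonneg φ i)
  have hle : ∀ i, r i ≤ J.sup' hJ r := by
    intro i
    by_cases hi : i ∈ J
    · exact Finset.le_sup' r hi
    · rw [hout i hi]; exact hsup.le
  have hrank : (coeffMatrix φ).rank ≤ J.card := by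
    rw [← Matrix.rank_self_mul_conjTranspose, ← traceB_pureDensity,
      (isHermitian_traceB_pureDensity φ).rank_eq_card_non_zero_eigs, Fintype.card_subtype]
    refine Finset.card_le_card fun i hi => ?_
    by_contra hiJ
    exact (Finset.mem_filter.1 hi).2 (hout i hiJ)
  have hpsd := posSemidef_smul_one_sub_of_eigenvalues_le (isHermitian_traceB_pureDensity φ) hle
  rw [traceB_pureDensity] at hpsd
  obtain ⟨K, hK, hKδ, hKle⟩ := P.exists_smoothing_set hφ hψ hδ₀ hδ₁ hεδ hF hJ.card_pos hrank
    hsup hpsd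
  have hfin := smoothDelta_le_logb (isHermitian_traceB_pureDensity ψ) hδ₁ hK hKδ hKle
  have hpow := (Real.le_logb_iff_rpow_le one_lt_two (by positivity)).1 hfin
  rw [le_div_iff₀ (by positivity)] at hpow
  rw [div_le_iff₀ (by positivity)]
  unfold entanglementDelta
  linarith

end EntanglementCost

theorem mainTheorem5 {a b a' b' : ℕ}
    (φ : EuclideanSpace ℂ (Fin a × Fin b)) (hφ : ‖φ‖ = 1)
    (ψ : EuclideanSpace ℂ (Fin a' × Fin b')) (hψ : ‖ψ‖ = 1)
    (ε : ℝ) (hε₀ : 0 ≤ ε) (hε : ε < 1 / 4)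
    (P : EntanglementCost.LOCC a' b' a b)
    (hF : 1 - ε ≤ EntanglementCost.fidelity (EntanglementCost.pureDensity ψ)
      (P.run (EntanglementCost.pureDensity φ)))
    (δ : ℝ) (hδ : δ = (4 * ε) ^ (1 / 8 : ℝ)) :
    P.bits ≥ EntanglementCost.entanglementDelta δ ψ - EntanglementCost.entanglementDelta 0 φ
      + 2 * Real.logb 2 (1 - δ) := by
  -- The smoothing argument needs `δ > 0`. For `ε = 0` it is applied with error `η ^ 8 / 4` and `η →
  -- 0⁺`.
  rcases hε₀.eq_or_lt with rfl | hpos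
  · have hδ0 : δ = 0 := by rw [hδ]; norm_num
    subst hδ0
    have hlim : Filter.Tendsto (fun η : ℝ => EntanglementCost.entanglementDelta 0 ψ
        - EntanglementCost.entanglementDelta 0 φ + 2 * Real.logb 2 (1 - η))
        (nhdsWithin 0 (Set.Ioi 0)) (nhds (EntanglementCost.entanglementDelta 0 ψ
        - EntanglementCost.entanglementDelta 0 φ + 2 * Real.logb 2 (1 - 0))) := by
      have hc : ContinuousAt (fun η : ℝ => Real.logb 2 (1 - η)) 0 :=
        (Real.continuousAt_logb (by norm_num)).comp (f := fun η : ℝ => 1 - η) (by fun_prop)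
      exact ((hc.tendsto.const_mul 2).const_add _).mono_left nhdsWithin_le_nhds
    refine le_of_tendsto hlim ?_
    filter_upwards [EntanglementCost.eventually_smoothDelta_eq
      (EntanglementCost.isHermitian_traceB_pureDensity ψ), Ioo_mem_nhdsGT one_pos] with η hη hη'
    have h := P.entanglementDelta_le hφ hψ (ε := η ^ 8 / 4) hη'.1 hη'.2 (by ring)
      (le_trans (by linarith [pow_pos hη'.1 8]) hF)
    unfold EntanglementCost.entanglementDelta at h ⊢
    rw [hη] at h
    linarith
  · have hδ8 : 4 * ε = δ ^ 8 := by
      rw [hδ, ← Real.rpow_natCast, ← Real.rpow_mul (by positivity)]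
      norm_num
    have hδ₀ : 0 < δ := by rw [hδ]; positivity
    have hδ₁ : δ < 1 := by
      rw [hδ]
      exact Real.rpow_lt_one (by positivity) (by linarith) (by norm_num)
    have h := P.entanglementDelta_le hφ hψ hδ₀ hδ₁ hδ8 hF
    linarith
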